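/- Let $\mathcal H$ be an infinite-dimensional separable (real or complex) Hilbert space, let $\{f_j\}_{j=1}^\infty$ be a linearly independent sequence in $\mathcal H$ (every finite subfamily is linearly independent), and let $\{e_j\}_{j=1}^\infty$ be an orthonormal basis of $\ell_2$ (over the same scalar field). Let $T\colon \ell_2\to\mathcal H$ be a bounded linear operator with $T(e_j)=f_j$ for all $j\ge 1$, and let $|T|=(T^*T)^{1/2}$ be the unique positive operator on $\ell_2$ whose square is $T^*T$. Assume that $I-|T|$ is a Hilbert–Schmidt operator on $\ell_2$, and that $$\dim\bigl((\operatorname{Ran} T)^\perp\bigr)<\dim(\operatorname{Ker} T).$$ Then there is no orthonormal basis $\{v_j\}_{j=1}^\infty$ of $\mathcal H$ with $\sum_{j=1}^\infty\|v_j-f_j\|^2<\infty$; that is, $\sum_{j=1}^\infty\|v_j-f_j\|^2=\infty$ for every orthonormal basis $\{v_j\}_{j=1}^\infty$ of $\mathcal H$. -/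

import Mathlib

/-!
Let `U` be the unitary with `U eⱼ = vⱼ`. If `∑ ‖vⱼ - fⱼ‖² < ∞`, then `U - T` is Hilbert–Schmidt, so
its restriction to the orthogonal complement of some finite-dimensional subspace `V` has norm less
than one. Hence `T = B - a b` with `B` invertible and `a b` factoring through `V`. The kernels of
`B - a b` and of its adjoint are isomorphic to those of the endomorphism `1 - b B⁻¹ a` of `V` and of
its adjoint, so they have equal dimension, and `ker T* = (Ran T)ᗮ`.
-/

/-! ### The positive square root of a positive operator on a real or complex Hilbert space -/

section SquareRoot

variable {𝕜 E : Type*} [RCLike 𝕜] [NormedAddCommGroup E] [InnerProductSpace 𝕜 E] [CompleteSpace E]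

theorem norm_one_sub_le_of_isPositive {A : E →L[𝕜] E} (hA : A.IsPositive) (h1 : ‖A‖ ≤ 1) :
    ‖1 - A‖ ≤ 1 := by
  refine ContinuousLinearMap.opNorm_le_bound _ zero_le_one fun x => ?_
  have hsym : ∀ x y, inner 𝕜 (A x) y = inner 𝕜 x (A y) := hA.inner_left_eq_inner_right
  have hpos : ∀ x, 0 ≤ RCLike.re (inner 𝕜 (A x) x) := hA.re_inner_nonneg_left
  have hn : ∀ x, ‖A x‖ ≤ ‖x‖ := fun x =>
    (A.le_opNorm x).trans (mul_le_of_le_one_left (norm_nonneg x) h1)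
  have e1 : RCLike.re (inner 𝕜 (A x) (A x)) = ‖A x‖ ^ 2 := inner_self_eq_norm_sq _
  have e2 : RCLike.re (inner 𝕜 x (A x)) = RCLike.re (inner 𝕜 (A x) x) := by rw [hsym]
  have e3 : RCLike.re (inner 𝕜 (A (A x)) (A x)) ≤ ‖A x‖ ^ 2 := by
    refine (RCLike.re_le_norm _).trans ((norm_inner_le_norm _ _).trans ?_)
    nlinarith [hn (A x), norm_nonneg (A x)]
  have e4 : RCLike.re (inner 𝕜 (A (A x)) x) = ‖A x‖ ^ 2 := by rw [hsym, e1]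
  have e5 : RCLike.re (inner 𝕜 (A x - A (A x)) (x - A x)) =
      RCLike.re (inner 𝕜 (A x) x) - ‖A x‖ ^ 2 - ‖A x‖ ^ 2
        + RCLike.re (inner 𝕜 (A (A x)) (A x)) := by
    simp only [inner_sub_left, inner_sub_right, map_sub, e1, e4]
    ring
  have e6 := hpos (x - A x)
  rw [map_sub, e5] at e6
  have e7 : ‖x - A x‖ ^ 2 = ‖x‖ ^ 2 - 2 * RCLike.re (inner 𝕜 (A x) x) + ‖A x‖ ^ 2 := by
    rw [@norm_sub_sq 𝕜, e2]
  have e8 : ‖x - A x‖ ^ 2 ≤ ‖x‖ ^ 2 := by nlinarith [sq_nonneg ‖A x‖]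
  simpa using (sq_le_sq₀ (norm_nonneg _) (norm_nonneg _)).1 e8

/-- Solution of `Y = (B + Y ^ 2) / 2` by iteration, for a self-adjoint contraction `B`. -/
theorem exists_sqrt_aux {B : E →L[𝕜] E} (hB : IsSelfAdjoint B) (hB1 : ‖B‖ ≤ 1) :
    ∃ Y : E →L[𝕜] E, IsSelfAdjoint Y ∧ ‖Y‖ ≤ 1 ∧ (1 - Y) * (1 - Y) = 1 - B ∧
      ∀ C : E →L[𝕜] E, Commute C B → Commute C Y := by
  let y : ℕ → (E →L[𝕜] E) := fun n => Nat.rec 0 (fun _ Y => (2⁻¹ : 𝕜) • (B + Y * Y)) n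
  let s : ℕ → ℝ := fun n => Nat.rec 0 (fun _ r => 2⁻¹ * (1 + r * r)) n
  have y0 : y 0 = 0 := rfl
  have s0 : s 0 = 0 := rfl
  have ys : ∀ n, y (n + 1) = (2⁻¹ : 𝕜) • (B + y n * y n) := fun n => rfl
  have ss : ∀ n, s (n + 1) = 2⁻¹ * (1 + s n * s n) := fun n => rfl
  have two : ‖(2⁻¹ : 𝕜)‖ = 2⁻¹ := by simp
  have s_pos : ∀ n, 0 ≤ s n := by
    intro n
    cases n with
    | zero => exact le_of_eq s0.symm
    | succ n => rw [ss]; nlinarith [mul_self_nonneg (s n)]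
  have s_le : ∀ n, s n ≤ 1 := by
    intro n
    induction n with
    | zero => rw [s0]; exact zero_le_one
    | succ n ih => rw [ss]; nlinarith [s_pos n]
  have y_le : ∀ n, ‖y n‖ ≤ s n := by
    intro n
    induction n with
    | zero => simp [y0, s0]
    | succ n ih =>
      rw [ys, ss, norm_smul, two]
      have h1 := norm_add_le B (y n * y n)
      have h2 := norm_mul_le (y n) (y n)
      have h3 := mul_self_le_mul_self (norm_nonneg (y n)) ih
      linarith
  have y_diff : ∀ n, ‖y (n + 1) - y n‖ ≤ s (n + 1) - s n := by
    intro n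
    induction n with
    | zero =>
      rw [ys, ss, y0, s0]
      simp only [mul_zero, add_zero, sub_zero, norm_smul, two]
      linarith
    | succ n ih =>
      have e : y (n + 1 + 1) - y (n + 1) =
          (2⁻¹ : 𝕜) • (y (n + 1) * (y (n + 1) - y n) + (y (n + 1) - y n) * y n) := by
        rw [ys (n + 1), ys n, ← smul_sub, ← ys n]
        congr 1
        noncomm_ring
      have e' : s (n + 1 + 1) - s (n + 1) =
          2⁻¹ * (s (n + 1) * (s (n + 1) - s n) + (s (n + 1) - s n) * s n) := by
        rw [ss (n + 1), ss n, ← mul_sub, ← ss n]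
        ring
      rw [e, e', norm_smul, two]
      have h0 := norm_add_le (y (n + 1) * (y (n + 1) - y n)) ((y (n + 1) - y n) * y n)
      have h1 := (norm_mul_le (y (n + 1)) (y (n + 1) - y n)).trans
        (mul_le_mul (y_le (n + 1)) ih (norm_nonneg _) (s_pos (n + 1)))
      have h2 := (norm_mul_le (y (n + 1) - y n) (y n)).trans
        (mul_le_mul ih (y_le n) (norm_nonneg _) ((norm_nonneg _).trans ih))
      linarith
  have hsum : Summable fun n => s (n + 1) - s n := by
    refine summable_of_sum_range_le (c := 1) (fun n => (norm_nonneg _).trans (y_diff n)) fun n => ?_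
    rw [Finset.sum_range_sub, s0, sub_zero]
    exact s_le n
  have hC : CauchySeq y := cauchySeq_of_dist_le_of_summable _
    (fun n => by rw [dist_comm, dist_eq_norm]; exact y_diff n) hsum
  obtain ⟨Y, hY⟩ := cauchySeq_tendsto_of_complete hC
  have y_sa : ∀ n, IsSelfAdjoint (y n) := by
    intro n
    induction n with
    | zero => rw [y0]; exact IsSelfAdjoint.zero _
    | succ n ih =>
      rw [ys]
      refine IsSelfAdjoint.smul ?_ (hB.add ?_)
      · simp [IsSelfAdjoint]
      · simpa [sq] using ih.pow 2
  have hlim : Y = (2⁻¹ : 𝕜) • (B + Y * Y) := by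
    refine tendsto_nhds_unique ((Filter.tendsto_add_atTop_iff_nat 1).2 hY) ?_
    simp only [ys]
    exact ((hY.mul hY).const_add B).const_smul _
  refine ⟨Y, ?_, ?_, ?_, ?_⟩
  · refine tendsto_nhds_unique (hY.star) ?_
    simpa only [(y_sa _).star_eq] using hY
  · exact le_of_tendsto hY.norm (Filter.Eventually.of_forall fun n => (y_le n).trans (s_le n))
  · have h2 : Y + Y = B + Y * Y := by
      rw [← two_smul 𝕜 Y]
      nth_rw 1 [hlim]
      rw [smul_smul, mul_inv_cancel₀ two_ne_zero, one_smul]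
    have h3 : (1 - Y) * (1 - Y) = 1 - (Y + Y) + Y * Y := by noncomm_ring
    rw [h3, h2]
    abel
  · intro C hCB
    have y_comm : ∀ n, Commute C (y n) := by
      intro n
      induction n with
      | zero => rw [y0]; exact Commute.zero_right C
      | succ n ih => rw [ys]; exact (hCB.add_right (ih.mul_right ih)).smul_right _
    refine tendsto_nhds_unique (hY.const_mul C) ?_
    simp only [fun n => (y_comm n).eq]
    exact hY.mul_const C

theorem exists_positive_sqrt {A : E →L[𝕜] E} (hA : A.IsPositive) :
    ∃ P : E →L[𝕜] E, (P.IsPositive ∧ P * P = A) ∧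
      ∀ C : E →L[𝕜] E, Commute C A → Commute C P := by
  set r : ℝ := ‖A‖ + 1 with hr
  have hr0 : 0 < r := by positivity
  have hpos : (((r⁻¹ : ℝ) : 𝕜) • A).IsPositive :=
    hA.smul_of_nonneg (by rw [RCLike.ofReal_nonneg]; positivity)
  have hle : ‖((r⁻¹ : ℝ) : 𝕜) • A‖ ≤ 1 := by
    rw [norm_smul, RCLike.norm_ofReal, abs_of_pos (by positivity), inv_mul_le_iff₀ hr0]
    linarith
  have hid : IsSelfAdjoint (1 : E →L[𝕜] E) := IsSelfAdjoint.one _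
  obtain ⟨Y, hYs, hY1, hYq, hYc⟩ := exists_sqrt_aux (hid.sub hpos.isSelfAdjoint)
    (norm_one_sub_le_of_isPositive hpos hle)
  rw [sub_sub_cancel] at hYq
  refine ⟨((√r : ℝ) : 𝕜) • (1 - Y), ⟨?_, ?_⟩, ?_⟩
  · refine ContinuousLinearMap.IsPositive.smul_of_nonneg ?_
      (by rw [RCLike.ofReal_nonneg]; positivity)
    rw [ContinuousLinearMap.isPositive_def']
    refine ⟨hid.sub hYs, fun x => ?_⟩
    rw [ContinuousLinearMap.reApplyInnerSelf_apply]
    simp only [sub_apply, one_apply_eq_self, inner_sub_left,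
      map_sub, inner_self_eq_norm_sq]
    have h1 : RCLike.re (inner 𝕜 (Y x) x) ≤ ‖Y x‖ * ‖x‖ :=
      (RCLike.re_le_norm _).trans (norm_inner_le_norm _ _)
    have h2 : ‖Y x‖ ≤ ‖x‖ := (Y.le_opNorm x).trans (mul_le_of_le_one_left (norm_nonneg x) hY1)
    nlinarith [norm_nonneg x]
  · rw [smul_mul_smul_comm, hYq, smul_smul, ← RCLike.ofReal_mul, Real.mul_self_sqrt hr0.le,
      ← RCLike.ofReal_mul, mul_inv_cancel₀ hr0.ne', RCLike.ofReal_one, one_smul]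
  · intro C hC
    refine Commute.smul_right (Commute.sub_right (Commute.one_right C) (hYc C ?_)) _
    exact (Commute.one_right C).sub_right (hC.smul_right _)

theorem existsUnique_positive_sqrt {A : E →L[𝕜] E} (hA : A.IsPositive) :
    ∃! P : E →L[𝕜] E, P.IsPositive ∧ P * P = A := by
  obtain ⟨P, hP, hc⟩ := exists_positive_sqrt hA
  refine ⟨P, hP, fun Q hQ => ?_⟩
  have hQA : Commute Q A := by rw [← hQ.2]; exact (Commute.refl Q).mul_right (Commute.refl Q)
  have hPQ : Q * P = P * Q := hc Q hQA
  have hzero : (Q + P) * (Q - P) = 0 := by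
    have : (Q + P) * (Q - P) = Q * Q - P * P - (Q * P - P * Q) := by noncomm_ring
    rw [this, hPQ, hP.2, hQ.2]
    simp
  ext x
  -- with `z = (Q - P) x` one has `(Q + P) z = 0`, hence `Q z = P z = 0`
  set z : E := (Q - P) x with hz
  have hz0 : Q z + P z = 0 := by simpa [hz] using congrArg (fun R : E →L[𝕜] E => R x) hzero
  have hsq : ∀ {R : E →L[𝕜] E}, R.IsPositive → RCLike.re (inner 𝕜 (R z) z) = 0 → R z = 0 := by
    intro R hR h
    obtain ⟨S, hS, -⟩ := exists_positive_sqrt hR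
    have h1 : inner 𝕜 (R z) z = inner 𝕜 (S z) (S z) := by
      rw [← hS.2]
      exact hS.1.inner_left_eq_inner_right (S z) z
    rw [h1, inner_self_eq_norm_sq] at h
    have h2 : S z = 0 := by simpa using h
    rw [← hS.2, mul_apply_eq_comp, h2, map_zero]
  have hsum : RCLike.re (inner 𝕜 (Q z) z) + RCLike.re (inner 𝕜 (P z) z) = 0 := by
    rw [← map_add, ← inner_add_left, hz0, inner_zero_left, map_zero]
  have hQ0 := hQ.1.re_inner_nonneg_left z
  have hP0 := hP.1.re_inner_nonneg_left z
  have hQz : Q z = 0 := hsq hQ.1 (by linarith)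
  have hPz : P z = 0 := hsq hP.1 (by linarith)
  have hnorm : inner 𝕜 z z = 0 := by
    nth_rw 1 [hz]
    rw [sub_apply, inner_sub_left, hQ.1.inner_left_eq_inner_right,
      hP.1.inner_left_eq_inner_right, hQz, hPz]
    simp
  have := inner_self_eq_zero.1 hnorm
  rw [hz, sub_apply] at this
  exact sub_eq_zero.1 this

end SquareRoot

/-! ### The modulus of a bounded operator between Hilbert spaces, Hilbert–Schmidt operators -/

section Operators

variable {𝕜 E F : Type*} [RCLike 𝕜] [NormedAddCommGroup E] [InnerProductSpace 𝕜 E]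
  [CompleteSpace E] [NormedAddCommGroup F] [InnerProductSpace 𝕜 F] [CompleteSpace F]

/-- The modulus `|T| = (T* T)^{1/2}` of a bounded operator `T`: the unique positive operator whose
square is `T* T`. -/
noncomputable def opAbs (T : E →L[𝕜] F) : E →L[𝕜] E :=
  (existsUnique_positive_sqrt (ContinuousLinearMap.isPositive_adjoint_comp_self T)).choose

theorem opAbs_isPositive (T : E →L[𝕜] F) : (opAbs T).IsPositive :=
  (existsUnique_positive_sqrt
    (ContinuousLinearMap.isPositive_adjoint_comp_self T)).choose_spec.1.1

theorem opAbs_mul_self (T : E →L[𝕜] F) :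
    opAbs T * opAbs T = (ContinuousLinearMap.adjoint T).comp T :=
  (existsUnique_positive_sqrt
    (ContinuousLinearMap.isPositive_adjoint_comp_self T)).choose_spec.1.2

theorem eq_opAbs {T : E →L[𝕜] F} {P : E →L[𝕜] E} (hP : P.IsPositive)
    (h : P * P = (ContinuousLinearMap.adjoint T).comp T) : P = opAbs T :=
  (existsUnique_positive_sqrt
    (ContinuousLinearMap.isPositive_adjoint_comp_self T)).choose_spec.2 P ⟨hP, h⟩

/-- On a complex Hilbert space `opAbs` is the absolute value of the continuous functional
calculus. -/
theorem opAbs_eq_cfcAbs {G : Type*} [NormedAddCommGroup G] [InnerProductSpace ℂ G]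
    [CompleteSpace G] (T : G →L[ℂ] G) : opAbs T = CFC.abs T :=
  (eq_opAbs ((ContinuousLinearMap.nonneg_iff_isPositive _).1 (CFC.abs_nonneg T))
    (CFC.abs_mul_abs T)).symm

/-- A bounded operator `A` is Hilbert–Schmidt if `∑ ‖A bᵢ‖² < ∞` for some orthonormal (Hilbert)
basis `b` of its domain; the value of the sum does not depend on the basis. -/
def IsHilbertSchmidt (A : E →L[𝕜] F) : Prop :=
  ∃ (ι : Set E) (b : HilbertBasis ι 𝕜 E), Summable fun i => ‖A (b i)‖ ^ 2

end Operators

universe u v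

/-- The isomorphism between the kernel of `B - a b`, where `B` is invertible, and the kernel of the
endomorphism `1 - b B⁻¹ a` of the module through which `a b` factors. It sends `x` to `b x`, and its
inverse sends `w` to `B⁻¹ (a w)`. -/
def kerSubCompEquiv {R M N V : Type*} [Ring R] [AddCommGroup M] [Module R M] [AddCommGroup N]
    [Module R N] [AddCommGroup V] [Module R V] (B : M ≃ₗ[R] N) (a : V →ₗ[R] N) (b : M →ₗ[R] V) :
    LinearMap.ker (B.toLinearMap - a ∘ₗ b) ≃ₗ[R]
      LinearMap.ker (LinearMap.id - b ∘ₗ B.symm.toLinearMap ∘ₗ a) :=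
  have symm_apply_eq_self {x : M} (hx : x ∈ LinearMap.ker (B.toLinearMap - a ∘ₗ b)) :
      B.symm (a (b x)) = x :=
    B.symm_apply_eq.2 (sub_eq_zero.1 hx).symm
  have apply_symm_eq_self {w : V}
      (hw : w ∈ LinearMap.ker (LinearMap.id - b ∘ₗ B.symm.toLinearMap ∘ₗ a)) :
      b (B.symm (a w)) = w := by
    rw [LinearMap.mem_ker, LinearMap.sub_apply, sub_eq_zero] at hw
    exact hw.symm
  .ofLinearMap
    (b.restrict fun _ hx => sub_eq_zero.2 (congrArg b (symm_apply_eq_self hx)).symm)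
    ((B.symm.toLinearMap ∘ₗ a).restrict fun w hw => sub_eq_zero.2 <|
      (B.apply_symm_apply (a w)).trans (congrArg a (apply_symm_eq_self hw)).symm)
    (LinearMap.ext fun w => Subtype.ext (apply_symm_eq_self w.2))
    (LinearMap.ext fun x => Subtype.ext (symm_apply_eq_self x.2))

theorem rank_ker_sub_comp {K M N V : Type*} [DivisionRing K] [AddCommGroup M] [Module K M]
    [AddCommGroup N] [Module K N] [AddCommGroup V] [Module K V] [FiniteDimensional K V]
    (B : M ≃ₗ[K] N) (a : V →ₗ[K] N) (b : M →ₗ[K] V) :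
    Module.rank K (LinearMap.ker (B.toLinearMap - a ∘ₗ b)) =
      Module.finrank K (LinearMap.ker (LinearMap.id - b ∘ₗ B.symm.toLinearMap ∘ₗ a)) := by
  rw [← Cardinal.lift_eq_nat_iff, (kerSubCompEquiv B a b).lift_rank_eq, ← Module.finrank_eq_rank,
    Cardinal.lift_natCast]

section FiniteRankPerturbation

open ContinuousLinearMap (adjoint)

variable {𝕜 V : Type*} {E : Type u} {F : Type v} [RCLike 𝕜]
  [NormedAddCommGroup V] [InnerProductSpace 𝕜 V] [FiniteDimensional 𝕜 V]
  [NormedAddCommGroup E] [InnerProductSpace 𝕜 E] [CompleteSpace E]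
  [NormedAddCommGroup F] [InnerProductSpace 𝕜 F] [CompleteSpace F]

theorem finrank_ker_adjoint (A : V →ₗ[𝕜] V) :
    Module.finrank 𝕜 (LinearMap.ker A.adjoint) = Module.finrank 𝕜 (LinearMap.ker A) := by
  have rank_nullity := A.finrank_range_add_finrank_ker
  have rank_nullity_adjoint := A.adjoint.finrank_range_add_finrank_ker
  rw [LinearMap.finrank_range_adjoint] at rank_nullity_adjoint
  omega

/-- The adjoint of an invertible operator, as an invertible operator. -/
noncomputable def adjointEquiv (B : E ≃L[𝕜] F) : F ≃L[𝕜] E :=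
  .equivOfInverse' (adjoint (B : E →L[𝕜] F)) (adjoint (B.symm : F →L[𝕜] E))
    (by rw [← ContinuousLinearMap.adjoint_comp, B.coe_symm_comp_coe,
      ContinuousLinearMap.adjoint_id])
    (by rw [← ContinuousLinearMap.adjoint_comp, B.coe_comp_coe_symm,
      ContinuousLinearMap.adjoint_id])

theorem rank_orthogonal_range_sub_comp (B : E ≃L[𝕜] F) (a : V →L[𝕜] F) (b : E →L[𝕜] V) :
    Module.rank 𝕜 (LinearMap.range ((B : E →L[𝕜] F) - a ∘L b).toLinearMap)ᗮ =
      Module.finrank 𝕜 (LinearMap.ker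
        (LinearMap.id - b.toLinearMap ∘ₗ B.symm.toLinearEquiv.toLinearMap ∘ₗ a.toLinearMap)) := by
  have : CompleteSpace V := FiniteDimensional.complete 𝕜 V
  have adjoint_endomorphism : LinearMap.adjoint
      (LinearMap.id - b.toLinearMap ∘ₗ B.symm.toLinearEquiv.toLinearMap ∘ₗ a.toLinearMap) =
      LinearMap.id - (adjoint a).toLinearMap ∘ₗ
        (adjointEquiv B).symm.toLinearEquiv.toLinearMap ∘ₗ (adjoint b).toLinearMap := by
    refine ((LinearMap.eq_adjoint_iff _ _).2 fun x y => ?_).symm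
    simp [inner_sub_left, inner_sub_right, ContinuousLinearMap.adjoint_inner_left, adjointEquiv]
  rw [ContinuousLinearMap.orthogonal_range, map_sub, ContinuousLinearMap.adjoint_comp,
    ← finrank_ker_adjoint, adjoint_endomorphism]
  exact rank_ker_sub_comp (adjointEquiv B).toLinearEquiv (adjoint b).toLinearMap
    (adjoint a).toLinearMap

theorem lift_rank_ker_sub_comp_eq_lift_rank_orthogonal_range (B : E ≃L[𝕜] F) (a : V →L[𝕜] F)
    (b : E →L[𝕜] V) :
    Cardinal.lift.{v} (Module.rank 𝕜 (LinearMap.ker ((B : E →L[𝕜] F) - a ∘L b).toLinearMap)) =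
      Cardinal.lift.{u}
        (Module.rank 𝕜 (LinearMap.range ((B : E →L[𝕜] F) - a ∘L b).toLinearMap)ᗮ) := by
  have rank_ker := rank_ker_sub_comp B.toLinearEquiv a.toLinearMap b.toLinearMap
  rw [rank_orthogonal_range_sub_comp, Cardinal.lift_natCast]
  exact Cardinal.lift_eq_nat_iff.2 rank_ker

theorem exists_continuousLinearEquiv_eq_sub_of_opNorm_lt_one {E F : Type*} [NormedAddCommGroup E]
    [NormedSpace 𝕜 E] [CompleteSpace E] [NormedAddCommGroup F] [NormedSpace 𝕜 F] (U : E ≃ₗᵢ[𝕜] F)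
    {R : E →L[𝕜] F} (hR : ‖R‖ < 1) : ∃ B : E ≃L[𝕜] F, (B : E →L[𝕜] F) = U - R := by
  have opNorm_lt_one : ‖(U.symm : F →L[𝕜] E) ∘L R‖ < 1 :=
    (U.symm.toLinearIsometry.norm_toContinuousLinearMap_comp (g := R)).trans_lt hR
  let B := ContinuousLinearEquiv.unitsEquiv 𝕜 E (Units.oneSub _ opNorm_lt_one)
  refine ⟨B.trans U.toContinuousLinearEquiv, ?_⟩
  ext x
  simp [B]

theorem lift_rank_ker_eq_lift_rank_orthogonal_range_of_opNorm_lt_one (U : E ≃ₗᵢ[𝕜] F)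
    (T : E →L[𝕜] F) (V : Submodule 𝕜 E) [FiniteDimensional 𝕜 V]
    (hV : ‖((U : E →L[𝕜] F) - T) ∘L Vᗮ.starProjection‖ < 1) :
    Cardinal.lift.{v} (Module.rank 𝕜 (LinearMap.ker T.toLinearMap)) =
      Cardinal.lift.{u} (Module.rank 𝕜 (LinearMap.range T.toLinearMap)ᗮ) := by
  obtain ⟨B, hB⟩ := exists_continuousLinearEquiv_eq_sub_of_opNorm_lt_one U hV
  have T_eq : T = B - (((U : E →L[𝕜] F) - T) ∘L V.subtypeL) ∘L V.orthogonalProjectionOnto := by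
    rw [hB, V.starProjection_orthogonal]
    ext x
    simp only [sub_apply, ContinuousLinearMap.comp_apply,
      ContinuousLinearMap.id_apply, Submodule.subtypeL_apply, Submodule.starProjection_apply,
      map_sub]
    abel
  rw [T_eq]
  exact lift_rank_ker_sub_comp_eq_lift_rank_orthogonal_range B _ _

end FiniteRankPerturbation

section HilbertSchmidt

variable {𝕜 E F ι : Type*} [RCLike 𝕜] [NormedAddCommGroup E] [InnerProductSpace 𝕜 E]

theorem starProjection_orthogonal_span_image_apply {v : ι → E} (hv : Orthonormal 𝕜 v)
    (s : Set ι) [(Submodule.span 𝕜 (v '' s)).HasOrthogonalProjection] (j : ι) :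
    (Submodule.span 𝕜 (v '' s))ᗮ.starProjection (v j) = sᶜ.indicator v j := by
  by_cases hj : j ∈ s
  · rw [Set.indicator_of_notMem (Set.notMem_compl_iff.2 hj),
      Submodule.starProjection_apply_eq_zero_iff]
    exact Submodule.le_orthogonal_orthogonal _ (Submodule.subset_span (Set.mem_image_of_mem v hj))
  · rw [Set.indicator_of_mem hj, Submodule.starProjection_eq_self_iff,
      ← Submodule.span_singleton_le_iff_mem, ← Submodule.isOrtho_iff_le, Submodule.isOrtho_span]
    rintro _ rfl _ ⟨i, hi, rfl⟩
    exact hv.inner_eq_zero (ne_of_mem_of_not_mem hi hj).symm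

variable [NormedAddCommGroup F] [NormedSpace 𝕜 F]

theorem opNorm_le_sqrt_tsum_sq_norm_apply (e : HilbertBasis ι 𝕜 E) (K : E →L[𝕜] F)
    (hK : Summable fun j => ‖K (e j)‖ ^ 2) : ‖K‖ ≤ √(∑' j, ‖K (e j)‖ ^ 2) := by
  refine K.opNorm_le_bound (Real.sqrt_nonneg _) fun x => ?_
  have expansion : HasSum (fun j => inner 𝕜 (e j) x • K (e j)) (K x) := by
    simpa [HilbertBasis.repr_apply_apply] using K.hasSum (e.hasSum_repr x)
  refine le_of_tendsto expansion.norm (.of_forall fun s => ?_)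
  calc ‖∑ j ∈ s, inner 𝕜 (e j) x • K (e j)‖
      ≤ ∑ j ∈ s, ‖inner 𝕜 (e j) x‖ * ‖K (e j)‖ := by
        simpa only [norm_smul] using norm_sum_le s fun j => inner 𝕜 (e j) x • K (e j)
    _ ≤ √(∑ j ∈ s, ‖inner 𝕜 (e j) x‖ ^ 2) * √(∑ j ∈ s, ‖K (e j)‖ ^ 2) :=
        Real.sum_mul_le_sqrt_mul_sqrt _ _ _
    _ ≤ ‖x‖ * √(∑' j, ‖K (e j)‖ ^ 2) := by
        gcongr
        · exact (Real.sqrt_le_left (norm_nonneg x)).2 (e.orthonormal.sum_inner_products_le x)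
        · exact hK.sum_le_tsum s fun j _ => sq_nonneg _
    _ = √(∑' j, ‖K (e j)‖ ^ 2) * ‖x‖ := mul_comm _ _

theorem exists_finiteDimensional_opNorm_comp_starProjection_orthogonal_lt
    (e : HilbertBasis ι 𝕜 E) (K : E →L[𝕜] F) (hK : Summable fun j => ‖K (e j)‖ ^ 2)
    {ε : ℝ} (hε : 0 < ε) :
    ∃ (V : Submodule 𝕜 E) (_ : FiniteDimensional 𝕜 V), ‖K ∘L Vᗮ.starProjection‖ < ε := by
  obtain ⟨s, tail_lt⟩ := ((tendsto_tsum_compl_atTop_zero fun j => ‖K (e j)‖ ^ 2).eventually_lt_const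
    (sq_pos_of_pos hε)).exists
  let V : Submodule 𝕜 E := Submodule.span 𝕜 (e '' s)
  have : FiniteDimensional 𝕜 V := .span_of_finite 𝕜 (s.finite_toSet.image e)
  have sq_norm_apply (j : ι) : ‖(K ∘L Vᗮ.starProjection) (e j)‖ ^ 2 =
      (sᶜ : Set ι).indicator (fun j => ‖K (e j)‖ ^ 2) j := by
    rw [ContinuousLinearMap.comp_apply, starProjection_orthogonal_span_image_apply e.orthonormal]
    by_cases hj : j ∈ s <;> simp [hj]
  refine ⟨V, this, ?_⟩
  calc ‖K ∘L Vᗮ.starProjection‖ ≤ √(∑' j, ‖(K ∘L Vᗮ.starProjection) (e j)‖ ^ 2) :=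
        opNorm_le_sqrt_tsum_sq_norm_apply e _ <| by
          simpa only [sq_norm_apply] using hK.indicator _
    _ = √(∑' j : ↥(sᶜ : Set ι), ‖K (e j)‖ ^ 2) := by
        rw [tsum_congr sq_norm_apply, tsum_subtype (sᶜ : Set ι) fun j => ‖K (e j)‖ ^ 2]
    _ < ε := (Real.sqrt_lt' hε).2 tail_lt

end HilbertSchmidt

theorem mainTheorem6_general {𝕜 ι : Type*} {E : Type u} {H : Type v} [RCLike 𝕜]
    [NormedAddCommGroup E] [InnerProductSpace 𝕜 E] [CompleteSpace E]
    [NormedAddCommGroup H] [InnerProductSpace 𝕜 H] [CompleteSpace H]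
    (e : HilbertBasis ι 𝕜 E) (v : HilbertBasis ι 𝕜 H) (f : ι → H)
    (T : E →L[𝕜] H) (hT : ∀ j, T (e j) = f j) (hf : Summable fun j => ‖v j - f j‖ ^ 2) :
    Cardinal.lift.{v} (Module.rank 𝕜 (LinearMap.ker T.toLinearMap)) =
      Cardinal.lift.{u} (Module.rank 𝕜 (LinearMap.range T.toLinearMap)ᗮ) := by
  classical
  let U : E ≃ₗᵢ[𝕜] H := e.repr.trans v.repr.symm
  have U_sub_T_apply (j : ι) : ((U : E →L[𝕜] H) - T) (e j) = v j - f j := by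
    change v.repr.symm (e.repr (e j)) - T (e j) = v j - f j
    rw [e.repr_self, v.repr_symm_single, hT]
  obtain ⟨V, _, hV⟩ := exists_finiteDimensional_opNorm_comp_starProjection_orthogonal_lt e
    ((U : E →L[𝕜] H) - T) (by simpa only [U_sub_T_apply] using hf) one_pos
  exact lift_rank_ker_eq_lift_rank_orthogonal_range_of_opNorm_lt_one U T V hV

theorem mainTheorem6 {𝕜 : Type u} {H : Type v} [RCLike 𝕜] [NormedAddCommGroup H]
    [InnerProductSpace 𝕜 H] [CompleteSpace H] [TopologicalSpace.SeparableSpace H]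
    (hH : ¬ FiniteDimensional 𝕜 H)
    (f : ℕ → H) (hf : LinearIndependent 𝕜 f)
    (e : HilbertBasis ℕ 𝕜 (lp (fun _ : ℕ => 𝕜) 2))
    (T : lp (fun _ : ℕ => 𝕜) 2 →L[𝕜] H) (hT : ∀ j, T (e j) = f j)
    (hHS : IsHilbertSchmidt (1 - opAbs T))
    (hdim : Cardinal.lift.{u} (Module.rank 𝕜 (LinearMap.range (T : lp (fun _ : ℕ => 𝕜) 2 →ₗ[𝕜] H))ᗮ)
      < Cardinal.lift.{v} (Module.rank 𝕜 (LinearMap.ker (T : lp (fun _ : ℕ => 𝕜) 2 →ₗ[𝕜] H)))) :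
    ∀ v : HilbertBasis ℕ 𝕜 H, ¬ Summable (fun j => ‖v j - f j‖ ^ 2) :=
  fun v hv => hdim.ne (mainTheorem6_general e v f T hT hv).symm
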